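/- Consider a Markov decision process with finite state space $\mathcal S$, finite action space $\mathcal A$, initial distribution $d$, transition probabilities $T(s'|s,a)$ and discount factor $\gamma\in(0,1)$. Let $\Pi$ be the set of stationary stochastic policies $\pi(a|s)$, and for $\pi\in\Pi$ and $f:\mathcal S\times\mathcal A\to\mathbb R^k$ write $\mathbb E_\pi[f(s,a)]=\mathbb E\big[\sum_{t\ge 0}\gamma^t f(s_t,a_t)\,\big|\,\pi,d\big]$. Let $W(\pi)=\tfrac12\mathbb E_\pi[1-\pi(a|s)]$ be the causal Tsallis entropy, let $\phi:\mathcal S\times\mathcal A\to\mathbb R^n$ be a feature map, $\pi_E\in\Pi$ the expert's policy, $\alpha>0$, and $\psi:\mathbb R^n\to\mathbb R\cup\{+\infty\}$ a convex function with conjugate $\psi^*(x)=\sup_{y\in\mathbb R^n}\{y^{\top}x-\psi(y)\}$. Put $$L(\theta,\pi)=-\alpha W(\pi)-\mathbb E_\pi[\theta^{\top}\phi(s,a)]+\mathbb E_{\pi_E}[\theta^{\top}\phi(s,a)]-\psi(\theta).$$ Then the problem $\max_{\theta\in\mathbb R^n}\min_{\pi\in\Pi}L(\theta,\pi)$ is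 equivalent to the problem $$\min_{\pi\in\Pi}\ F(\pi),\qquad F(\pi)=\psi^*\big(\mathbb E_{\pi_E}[\phi(s,a)]-\mathbb E_{\pi}[\phi(s,a)]\big)-\alpha W(\pi),$$ in the following sense. All the minima are attained; the optimal values agree in $[-\infty,+\infty]$, that is, $\sup_{\theta}\min_{\pi\in\Pi}L(\theta,\pi)=\min_{\pi\in\Pi}F(\pi)$; and whenever $\theta^\star$ attains the supremum over $\theta$, the minimizers of $L(\theta^\star,\cdot)$ over $\Pi$ are exactly the minimizers of $F$ over $\Pi$. If moreover $\psi(-\theta)=\psi(\theta)$ for all $\theta$, the same equivalence holds with $\psi^*\big(\mathbb E_{\pi}[\phi(s,a)]-\mathbb E_{\pi_E}[\phi(s,a)]\big)$ in place of $\psi^*\big(\mathbb E_{\pi_E}[\phi(s,a)]-\mathbb E_{\pi}[\phi(s,a)]\big)$. -/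

import Mathlib

noncomputable section

/-- The data of a discounted Markov decision process with finite state space `S` and finite action
space `A`: initial distribution `d`, transition probabilities `T s a s'` (the probability of moving
from `s` to `s'` under action `a`), and discount factor `γ ∈ (0,1)`. -/
structure FiniteMDP (S A : Type*) [Fintype S] [Fintype A] where
  d : S → ℝ
  d_nonneg : ∀ s, 0 ≤ d s
  d_sum : ∑ s, d s = 1
  T : S → A → S → ℝ
  T_nonneg : ∀ s a s', 0 ≤ T s a s'
  T_sum : ∀ s a, ∑ s', T s a s' = 1
  γ : ℝ
  γ_pos : 0 < γ
  γ_lt_one : γ < 1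

/-- The set of stationary stochastic policies; `π s a` is the probability of `a` in state `s`. -/
def policies (S A : Type*) [Fintype A] : Set (S → A → ℝ) :=
  {π | ∀ s, (∀ a, 0 ≤ π s a) ∧ ∑ a, π s a = 1}

namespace FiniteMDP

variable {S A : Type*} [Fintype S] [Fintype A]

/-- The law of the state `s_t` of the Markov chain started from `d` and driven by the policy `π`. -/
def stateLaw (M : FiniteMDP S A) (π : S → A → ℝ) : ℕ → S → ℝ
  | 0 => M.d
  | t + 1 => fun s' => ∑ s, ∑ a, stateLaw M π t s * π s a * M.T s a s'

/-- The discounted expectation `E_π[f(s,a)] = ∑ t, γ ^ t * E[f(s_t,a_t) | π, d]`. -/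
def expect (M : FiniteMDP S A) (π : S → A → ℝ) (f : S → A → ℝ) : ℝ :=
  ∑' t : ℕ, M.γ ^ t * ∑ s, ∑ a, M.stateLaw π t s * π s a * f s a

/-- The feature expectation `E_π[φ(s,a)]`, taken coordinatewise. -/
def featureExpect {n : ℕ} (M : FiniteMDP S A) (φ : S → A → Fin n → ℝ) (π : S → A → ℝ) :
    Fin n → ℝ :=
  fun i => M.expect π (fun s a => φ s a i)

/-- The causal Tsallis entropy `W(π) = (1/2) E_π[1 - π(a|s)]`. -/
def tsallisEntropy (M : FiniteMDP S A) (π : S → A → ℝ) : ℝ :=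
  (1 / 2) * M.expect π (fun s a => 1 - π s a)

/-- The objective
`-α W(π) - E_π[θᵀφ(s,a)] + E_{π_E}[θᵀφ(s,a)] - ψ(θ)` of the regularized max-min problem. -/
def maxMinObjective {n : ℕ} (M : FiniteMDP S A) (φ : S → A → Fin n → ℝ)
    (ψ : (Fin n → ℝ) → EReal) (α : ℝ) (πE : S → A → ℝ) (θ : Fin n → ℝ) (π : S → A → ℝ) : EReal :=
  ((-α * M.tsallisEntropy π - M.expect π (fun s a => θ ⬝ᵥ φ s a)
    + M.expect πE (fun s a => θ ⬝ᵥ φ s a) : ℝ) : EReal) - ψ θ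

end FiniteMDP

/-- Convexity of an extended-real-valued function: its epigraph is convex. -/
def ConvexEReal {n : ℕ} (ψ : (Fin n → ℝ) → EReal) : Prop :=
  Convex ℝ {p : (Fin n → ℝ) × ℝ | ψ p.1 ≤ (p.2 : EReal)}

/-- The convex conjugate `ψ*(x) = sup_y {yᵀx - ψ(y)}`. -/
def convexConjugate {n : ℕ} (ψ : (Fin n → ℝ) → EReal) (x : Fin n → ℝ) : EReal :=
  ⨆ y : Fin n → ℝ, ((y ⬝ᵥ x : ℝ) : EReal) - ψ y

/-- The set of minimizers of `F` over `P`. -/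
def minimizers {X : Type*} (P : Set X) (F : X → EReal) : Set X :=
  {x | x ∈ P ∧ IsMinOn F P x}

/-- The problem `max_θ min_{x ∈ P} L θ x` is equivalent to the problem `min_{x ∈ P} F x`:
all minima are attained, the two optimal values agree, and whenever `θ` solves the outer
maximization, the solutions of the inner minimization at `θ` are exactly the solutions of the
second problem. -/
structure MaxMinEquivMin {Θ X : Type*} (P : Set X) (L : Θ → X → EReal) (F : X → EReal) : Prop where
  inner_min_attained : ∀ θ, (minimizers P (L θ)).Nonempty
  min_attained : (minimizers P F).Nonempty
  value_eq : (⨆ θ, ⨅ x ∈ P, L θ x) = ⨅ x ∈ P, F x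
  solutions_eq : ∀ θ, (∀ θ', (⨅ x ∈ P, L θ' x) ≤ ⨅ x ∈ P, L θ x) →
    minimizers P (L θ) = minimizers P F

end

/-! In the policy itself neither `E_π` nor `W` has a useful convexity, but in the discounted
occupancy `E_π` is linear and `W` is concave, with equality in the concavity inequality only between
equal occupancies. Occupancies form a convex set because the Bellman flow equation is affine and has
a unique solution (`IsFlow.unique`); `exists_combination` transports this back to policies. Since
`F` is the supremum over `θ` of `L θ`, equality of values is a minimax statement. For finitely many
`θ` it follows by separating convex sets (`exists_forall_lt_of_convexLike`), for all `θ` by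
compactness of the policies. At an optimal `θ`, the bound `L θ ≤ F` and equality of values make
every minimizer of `F` minimize `L θ`. Conversely, strictness forces all minimizers of `L θ` to
share feature expectation and entropy, hence the value of `F`. -/

noncomputable section

namespace FiniteMDP

variable {S A : Type*} [Fintype S] [Fintype A]

/-! ### State laws and discounted occupancies -/

theorem stateLaw_nonneg (M : FiniteMDP S A) {π : S → A → ℝ} (hπ : π ∈ policies S A) (t : ℕ)
    (s : S) : 0 ≤ M.stateLaw π t s := by
  induction t generalizing s with
  | zero => exact M.d_nonneg s
  | succ t ih =>
    exact Finset.sum_nonneg fun x _ => Finset.sum_nonneg fun a _ =>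
      mul_nonneg (mul_nonneg (ih x) ((hπ x).1 a)) (M.T_nonneg x a s)

/-- The policy-driven transition operator preserves total mass. -/
theorem sum_transition (M : FiniteMDP S A) {π : S → A → ℝ} (hπ : π ∈ policies S A) (ν : S → ℝ) :
    ∑ s', ∑ s, ∑ a, ν s * π s a * M.T s a s' = ∑ s, ν s := by
  rw [Finset.sum_comm]
  refine Finset.sum_congr rfl fun s _ => ?_
  rw [Finset.sum_comm]
  simp_rw [← Finset.mul_sum, M.T_sum, mul_one, ← Finset.mul_sum, (hπ s).2, mul_one]

theorem sum_stateLaw (M : FiniteMDP S A) {π : S → A → ℝ} (hπ : π ∈ policies S A) (t : ℕ) :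
    ∑ s, M.stateLaw π t s = 1 := by
  induction t with
  | zero => exact M.d_sum
  | succ t ih => exact (M.sum_transition hπ _).trans ih

theorem stateLaw_le_one (M : FiniteMDP S A) {π : S → A → ℝ} (hπ : π ∈ policies S A) (t : ℕ)
    (s : S) : M.stateLaw π t s ≤ 1 := by
  rw [← M.sum_stateLaw hπ t]
  exact Finset.single_le_sum (fun x _ => M.stateLaw_nonneg hπ t x) (Finset.mem_univ s)

theorem norm_discounted_stateLaw_le (M : FiniteMDP S A) {π : S → A → ℝ} (hπ : π ∈ policies S A)
    (t : ℕ) (s : S) : ‖M.γ ^ t * M.stateLaw π t s‖ ≤ M.γ ^ t := by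
  have hγ : 0 ≤ M.γ ^ t := pow_nonneg M.γ_pos.le t
  rw [Real.norm_of_nonneg (mul_nonneg hγ (M.stateLaw_nonneg hπ t s))]
  exact mul_le_of_le_one_right hγ (M.stateLaw_le_one hπ t s)

theorem summable_discount (M : FiniteMDP S A) : Summable fun t : ℕ => M.γ ^ t :=
  summable_geometric_of_lt_one M.γ_pos.le M.γ_lt_one

theorem summable_discounted_stateLaw (M : FiniteMDP S A) {π : S → A → ℝ}
    (hπ : π ∈ policies S A) (s : S) : Summable fun t : ℕ => M.γ ^ t * M.stateLaw π t s :=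
  Summable.of_norm_bounded M.summable_discount fun t => M.norm_discounted_stateLaw_le hπ t s

/-- The discounted state occupancy `∑ t, γ ^ t * P(s_t = s)`. -/
def stateOccupancy (M : FiniteMDP S A) (π : S → A → ℝ) (s : S) : ℝ :=
  ∑' t : ℕ, M.γ ^ t * M.stateLaw π t s

theorem stateOccupancy_nonneg (M : FiniteMDP S A) {π : S → A → ℝ} (hπ : π ∈ policies S A)
    (s : S) : 0 ≤ M.stateOccupancy π s :=
  tsum_nonneg fun t => mul_nonneg (pow_nonneg M.γ_pos.le t) (M.stateLaw_nonneg hπ t s)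

theorem expect_eq (M : FiniteMDP S A) {π : S → A → ℝ} (hπ : π ∈ policies S A) (f : S → A → ℝ) :
    M.expect π f = ∑ s, ∑ a, M.stateOccupancy π s * π s a * f s a := by
  have h : HasSum (fun t : ℕ => ∑ s, ∑ a, M.γ ^ t * M.stateLaw π t s * (π s a * f s a))
      (∑ s, ∑ a, M.stateOccupancy π s * (π s a * f s a)) :=
    hasSum_sum fun s _ => hasSum_sum fun a _ =>
      (M.summable_discounted_stateLaw hπ s).hasSum.mul_right _
  simp_rw [mul_assoc _ (π _ _) (f _ _), ← h.tsum_eq, expect, Finset.mul_sum, mul_assoc]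

/-! ### The Bellman flow equation -/

/-- `ν` satisfies the discounted Bellman flow equation of the policy `π`. -/
def IsFlow (M : FiniteMDP S A) (π : S → A → ℝ) (ν : S → ℝ) : Prop :=
  ∀ s', ν s' = M.d s' + M.γ * ∑ s, ∑ a, ν s * π s a * M.T s a s'

theorem isFlow_stateOccupancy (M : FiniteMDP S A) {π : S → A → ℝ} (hπ : π ∈ policies S A) :
    M.IsFlow π (M.stateOccupancy π) := by
  intro s'
  have h : HasSum (fun t : ℕ => M.γ * ∑ s, ∑ a, M.γ ^ t * M.stateLaw π t s * (π s a * M.T s a s'))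
      (M.γ * ∑ s, ∑ a, M.stateOccupancy π s * (π s a * M.T s a s')) :=
    (hasSum_sum fun s _ => hasSum_sum fun a _ =>
      (M.summable_discounted_stateLaw hπ s).hasSum.mul_right _).mul_left _
  rw [stateOccupancy, (M.summable_discounted_stateLaw hπ s').tsum_eq_zero_add]
  simp_rw [mul_assoc _ (π _ _) (M.T _ _ _), ← h.tsum_eq, stateLaw, pow_zero, one_mul,
    Finset.mul_sum, pow_succ']
  simp only [mul_assoc]

/-- The transition operator of a policy does not increase the ℓ¹ norm, so the factor `γ < 1` makes
the flow equation a contraction. -/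
theorem IsFlow.unique {M : FiniteMDP S A} {π : S → A → ℝ} (hπ : π ∈ policies S A) {ν ν' : S → ℝ}
    (h : M.IsFlow π ν) (h' : M.IsFlow π ν') : ν = ν' := by
  have key : ∑ s, |ν s - ν' s| ≤ M.γ * ∑ s, |ν s - ν' s| := by
    conv_rhs => rw [← M.sum_transition hπ, Finset.mul_sum]
    refine Finset.sum_le_sum fun s' _ => ?_
    have : ν s' - ν' s' = M.γ * ∑ s, ∑ a, (ν s - ν' s) * π s a * M.T s a s' := by
      rw [h s', h' s']
      simp_rw [sub_mul, Finset.sum_sub_distrib]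
      ring
    rw [this, abs_mul, abs_of_pos M.γ_pos]
    refine mul_le_mul_of_nonneg_left ?_ M.γ_pos.le
    refine (Finset.abs_sum_le_sum_abs _ _).trans (Finset.sum_le_sum fun s _ => ?_)
    refine (Finset.abs_sum_le_sum_abs _ _).trans (Finset.sum_le_sum fun a _ => ?_)
    rw [abs_mul, abs_mul, abs_of_nonneg ((hπ s).1 a), abs_of_nonneg (M.T_nonneg s a s')]
  have h0 : ∑ s, |ν s - ν' s| = 0 := by
    have hn : 0 ≤ ∑ s, |ν s - ν' s| := Finset.sum_nonneg fun s _ => abs_nonneg _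
    nlinarith [M.γ_lt_one]
  funext s
  have := (Finset.sum_eq_zero_iff_of_nonneg fun s _ => abs_nonneg _).1 h0 s (Finset.mem_univ s)
  exact sub_eq_zero.1 (abs_eq_zero.1 this)

/-- A policy enters the flow equation only through the products `ν s * π s a`, so it may be altered
freely where `ν` vanishes. -/
theorem IsFlow.congr {M : FiniteMDP S A} {π π' : S → A → ℝ} {ν : S → ℝ} (h : M.IsFlow π ν)
    (hπ : ∀ s a, ν s * π s a = ν s * π' s a) : M.IsFlow π' ν := by
  intro s'
  rw [h s']
  simp_rw [hπ]

/-- The discounted state-action occupancy of a policy. -/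
def occupancy (M : FiniteMDP S A) (π : S → A → ℝ) (s : S) (a : A) : ℝ :=
  M.stateOccupancy π s * π s a

theorem sum_occupancy (M : FiniteMDP S A) {π : S → A → ℝ} (hπ : π ∈ policies S A) (s : S) :
    ∑ a, M.occupancy π s a = M.stateOccupancy π s := by
  simp_rw [occupancy, ← Finset.mul_sum, (hπ s).2, mul_one]

theorem tsallisEntropy_eq (M : FiniteMDP S A) {π : S → A → ℝ} (hπ : π ∈ policies S A) :
    M.tsallisEntropy π =
      (1 / 2) * ∑ s, ∑ a, (M.occupancy π s a - M.stateOccupancy π s * π s a ^ 2) := by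
  rw [tsallisEntropy, M.expect_eq hπ]
  congr 1
  refine Finset.sum_congr rfl fun s _ => Finset.sum_congr rfl fun a _ => ?_
  rw [occupancy]
  ring

theorem expect_congr_occupancy (M : FiniteMDP S A) {π π' : S → A → ℝ} (hπ : π ∈ policies S A)
    (hπ' : π' ∈ policies S A) (h : M.occupancy π = M.occupancy π') (f : S → A → ℝ) :
    M.expect π f = M.expect π' f := by
  rw [M.expect_eq hπ, M.expect_eq hπ']
  exact Finset.sum_congr rfl fun s _ => Finset.sum_congr rfl fun a _ =>
    congrArg (· * f s a) (congrFun (congrFun h s) a)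

theorem tsallisEntropy_congr_occupancy (M : FiniteMDP S A) {π π' : S → A → ℝ}
    (hπ : π ∈ policies S A) (hπ' : π' ∈ policies S A) (h : M.occupancy π = M.occupancy π') :
    M.tsallisEntropy π = M.tsallisEntropy π' := by
  rw [M.tsallisEntropy_eq hπ, M.tsallisEntropy_eq hπ']
  congr 1
  refine Finset.sum_congr rfl fun s _ => Finset.sum_congr rfl fun a _ => ?_
  have hs : M.stateOccupancy π s = M.stateOccupancy π' s := by
    rw [← M.sum_occupancy hπ, ← M.sum_occupancy hπ', h]
  have ha : M.stateOccupancy π s * π s a = M.stateOccupancy π s * π' s a := by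
    have := congrFun (congrFun h s) a
    rwa [occupancy, occupancy, ← hs] at this
  rw [h, ← hs]
  congr 1
  rcases mul_eq_mul_left_iff.1 ha with h1 | h1 <;> simp [h1]

/-! ### Mixing occupancies and strict concavity of the entropy -/

/-- A weighted mean of squares dominates the square of the weighted mean. -/
theorem mul_sq_le_of_mul_eq {p q x x₁ x₂ : ℝ} (hp : 0 ≤ p) (hq : 0 ≤ q)
    (hx : (p + q) * x = p * x₁ + q * x₂) : (p + q) * x ^ 2 ≤ p * x₁ ^ 2 + q * x₂ ^ 2 := by
  have h : p * x₁ ^ 2 + q * x₂ ^ 2 - (p + q) * x ^ 2 = p * (x₁ - x) ^ 2 + q * (x₂ - x) ^ 2 := by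
    linear_combination (-(2 * x)) * hx
  nlinarith [mul_nonneg hp (sq_nonneg (x₁ - x)), mul_nonneg hq (sq_nonneg (x₂ - x))]

theorem eq_of_mul_sq_eq {p q x x₁ x₂ : ℝ} (hp : 0 < p) (hq : 0 < q)
    (hx : (p + q) * x = p * x₁ + q * x₂) (h : (p + q) * x ^ 2 = p * x₁ ^ 2 + q * x₂ ^ 2) :
    x₁ = x₂ := by
  have h0 : p * (x₁ - x) ^ 2 + q * (x₂ - x) ^ 2 = 0 := by
    linear_combination -h + (2 * x) * hx
  have h1 := mul_nonneg hp.le (sq_nonneg (x₁ - x))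
  have h2 := mul_nonneg hq.le (sq_nonneg (x₂ - x))
  have e1 : (x₁ - x) ^ 2 = 0 := (mul_eq_zero.1 (by linarith)).resolve_left hp.ne'
  have e2 : (x₂ - x) ^ 2 = 0 := (mul_eq_zero.1 (by linarith)).resolve_left hq.ne'
  have e1 := pow_eq_zero_iff (two_ne_zero) |>.1 e1
  have e2 := pow_eq_zero_iff (two_ne_zero) |>.1 e2
  linarith

/-- Convex combinations of occupancies are occupancies. -/
theorem exists_occupancy_eq_combination (M : FiniteMDP S A) {π₁ π₂ : S → A → ℝ}
    (h₁ : π₁ ∈ policies S A) (h₂ : π₂ ∈ policies S A) {p q : ℝ} (hp : 0 ≤ p) (hq : 0 ≤ q)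
    (hpq : p + q = 1) :
    ∃ π ∈ policies S A,
      (∀ s, M.stateOccupancy π s = p * M.stateOccupancy π₁ s + q * M.stateOccupancy π₂ s) ∧
      ∀ s a, M.occupancy π s a = p * M.occupancy π₁ s a + q * M.occupancy π₂ s a := by
  classical
  set ν : S → ℝ := fun s => p * M.stateOccupancy π₁ s + q * M.stateOccupancy π₂ s with hν
  have n₁ := fun s => mul_nonneg hp (M.stateOccupancy_nonneg h₁ s)
  have n₂ := fun s => mul_nonneg hq (M.stateOccupancy_nonneg h₂ s)
  -- Normalize the mixed occupancy; at states of zero mass any action distribution would do, and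
  -- `π₁` is the default.
  set π : S → A → ℝ := fun s a => if ν s = 0 then π₁ s a else
    (p * M.occupancy π₁ s a + q * M.occupancy π₂ s a) / ν s with hπdef
  have hνπ : ∀ s a, ν s * π s a = p * M.occupancy π₁ s a + q * M.occupancy π₂ s a := by
    intro s a
    by_cases h : ν s = 0
    · have e₁ : p * M.stateOccupancy π₁ s = 0 := by linarith [n₁ s, n₂ s, h]
      have e₂ : q * M.stateOccupancy π₂ s = 0 := by linarith [n₁ s, n₂ s, h]
      simp only [occupancy, ← mul_assoc, e₁, e₂, h, zero_mul, add_zero]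
    · simp only [hπdef, if_neg h]
      field_simp
  have hπ : π ∈ policies S A := by
    intro s
    by_cases h : ν s = 0
    · simpa only [hπdef, if_pos h] using h₁ s
    · have hpos : 0 ≤ ν s := add_nonneg (n₁ s) (n₂ s)
      simp only [hπdef, if_neg h]
      refine ⟨fun a => div_nonneg (add_nonneg ?_ ?_) hpos, ?_⟩
      · exact mul_nonneg hp (mul_nonneg (M.stateOccupancy_nonneg h₁ s) ((h₁ s).1 a))
      · exact mul_nonneg hq (mul_nonneg (M.stateOccupancy_nonneg h₂ s) ((h₂ s).1 a))
      · rw [← Finset.sum_div, Finset.sum_add_distrib, ← Finset.mul_sum, ← Finset.mul_sum,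
          M.sum_occupancy h₁, M.sum_occupancy h₂]
        exact div_self h
  have hflow : M.IsFlow π ν := by
    intro s'
    simp_rw [hνπ, add_mul, Finset.sum_add_distrib, mul_assoc p, mul_assoc q, ← Finset.mul_sum]
    simp only [hν]
    rw [M.isFlow_stateOccupancy h₁ s', M.isFlow_stateOccupancy h₂ s']
    simp only [occupancy]
    linear_combination M.d s' * hpq
  have heq : M.stateOccupancy π = ν := (M.isFlow_stateOccupancy hπ).unique hπ hflow
  refine ⟨π, hπ, fun s => congrFun heq s, fun s a => ?_⟩
  rw [occupancy, heq, hνπ]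

/-- The causal Tsallis entropy is concave as a function of the occupancy, strictly so in the sense
that equality forces the occupancies to agree. -/
theorem exists_combination (M : FiniteMDP S A) {π₁ π₂ : S → A → ℝ}
    (h₁ : π₁ ∈ policies S A) (h₂ : π₂ ∈ policies S A) {p q : ℝ} (hp : 0 ≤ p) (hq : 0 ≤ q)
    (hpq : p + q = 1) :
    ∃ π ∈ policies S A,
      (∀ f, M.expect π f = p * M.expect π₁ f + q * M.expect π₂ f) ∧
      p * M.tsallisEntropy π₁ + q * M.tsallisEntropy π₂ ≤ M.tsallisEntropy π ∧
      (0 < p → 0 < q →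
        M.tsallisEntropy π = p * M.tsallisEntropy π₁ + q * M.tsallisEntropy π₂ →
        M.occupancy π₁ = M.occupancy π₂) := by
  classical
  obtain ⟨π, hπ, hs, ha⟩ := M.exists_occupancy_eq_combination h₁ h₂ hp hq hpq
  have n₁ := fun s => M.stateOccupancy_nonneg h₁ s
  have n₂ := fun s => M.stateOccupancy_nonneg h₂ s
  have hx : ∀ s a, (p * M.stateOccupancy π₁ s + q * M.stateOccupancy π₂ s) * π s a =
      p * M.stateOccupancy π₁ s * π₁ s a + q * M.stateOccupancy π₂ s * π₂ s a := by
    intro s a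
    have := ha s a
    rw [occupancy, hs] at this
    simp only [this, occupancy, mul_assoc]
  have hcomb : p * M.tsallisEntropy π₁ + q * M.tsallisEntropy π₂ = (1 / 2) * ∑ s, ∑ a,
      (M.occupancy π s a - (p * M.stateOccupancy π₁ s * π₁ s a ^ 2
        + q * M.stateOccupancy π₂ s * π₂ s a ^ 2)) := by
    rw [M.tsallisEntropy_eq h₁, M.tsallisEntropy_eq h₂, mul_left_comm p, mul_left_comm q,
      ← mul_add]
    congr 1
    simp_rw [Finset.mul_sum, ← Finset.sum_add_distrib, ha]
    refine Finset.sum_congr rfl fun s _ => Finset.sum_congr rfl fun a _ => ?_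
    ring
  have hle : ∀ s a, M.occupancy π s a - (p * M.stateOccupancy π₁ s * π₁ s a ^ 2
      + q * M.stateOccupancy π₂ s * π₂ s a ^ 2) ≤
      M.occupancy π s a - M.stateOccupancy π s * π s a ^ 2 := by
    intro s a
    rw [hs]
    exact sub_le_sub_left (mul_sq_le_of_mul_eq (mul_nonneg hp (n₁ s)) (mul_nonneg hq (n₂ s))
      (hx s a)) _
  refine ⟨π, hπ, fun f => ?_, ?_, fun hp' hq' heq => ?_⟩
  · rw [M.expect_eq hπ, M.expect_eq h₁, M.expect_eq h₂]
    simp_rw [Finset.mul_sum, ← Finset.sum_add_distrib]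
    refine Finset.sum_congr rfl fun s _ => Finset.sum_congr rfl fun a _ => ?_
    have := ha s a
    simp only [occupancy] at this
    rw [this]
    ring
  · rw [hcomb, M.tsallisEntropy_eq hπ]
    exact mul_le_mul_of_nonneg_left
      (Finset.sum_le_sum fun s _ => Finset.sum_le_sum fun a _ => hle s a) (by norm_num)
  · rw [hcomb, M.tsallisEntropy_eq hπ] at heq
    have heq' := (mul_left_cancel₀ (by norm_num) heq).symm
    rw [Finset.sum_eq_sum_iff_of_le fun s _ => Finset.sum_le_sum fun a _ => hle s a] at heq'
    have hterm : ∀ s a, M.stateOccupancy π s * π s a ^ 2 =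
        p * M.stateOccupancy π₁ s * π₁ s a ^ 2 + q * M.stateOccupancy π₂ s * π₂ s a ^ 2 := by
      intro s a
      have := (Finset.sum_eq_sum_iff_of_le fun a _ => hle s a).1 (heq' s (Finset.mem_univ s)) a
        (Finset.mem_univ a)
      linarith
    have hpi : ∀ s, M.stateOccupancy π₁ s ≠ 0 → M.stateOccupancy π₂ s ≠ 0 → π₁ s = π₂ s := by
      intro s g₁ g₂
      funext a
      refine eq_of_mul_sq_eq (mul_pos hp' ((n₁ s).lt_of_ne' g₁)) (mul_pos hq' ((n₂ s).lt_of_ne' g₂))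
        (hx s a) ?_
      rw [← hs]
      exact hterm s a
    -- Equality in the entropy only identifies the policies where both occupancies are positive.
    -- Gluing them gives one policy for which both state occupancies are flows, so uniqueness
    -- identifies these too.
    set π' : S → A → ℝ := fun s => if M.stateOccupancy π₁ s = 0 then π₂ s else π₁ s with hπ'
    have hπ'mem : π' ∈ policies S A := by
      intro s
      by_cases h : M.stateOccupancy π₁ s = 0
      · simpa only [hπ', if_pos h] using h₂ s
      · simpa only [hπ', if_neg h] using h₁ s
    have c₁ : ∀ s a, M.stateOccupancy π₁ s * π₁ s a = M.stateOccupancy π₁ s * π' s a := by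
      intro s a
      by_cases h : M.stateOccupancy π₁ s = 0
      · simp only [h, zero_mul]
      · simp only [hπ', if_neg h]
    have c₂ : ∀ s a, M.stateOccupancy π₂ s * π₂ s a = M.stateOccupancy π₂ s * π' s a := by
      intro s a
      by_cases h : M.stateOccupancy π₁ s = 0
      · simp only [hπ', if_pos h]
      · by_cases h' : M.stateOccupancy π₂ s = 0
        · simp only [h', zero_mul]
        · simp only [hπ', if_neg h, hpi s h h']
    have e : M.stateOccupancy π₁ = M.stateOccupancy π₂ :=
      ((M.isFlow_stateOccupancy h₁).congr c₁).unique hπ'mem ((M.isFlow_stateOccupancy h₂).congr c₂)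
    funext s a
    rw [occupancy, occupancy, c₁, c₂, e]

/-! ### Continuity and compactness -/

theorem continuous_stateLaw (M : FiniteMDP S A) (t : ℕ) (s : S) :
    Continuous fun π : S → A → ℝ => M.stateLaw π t s := by
  induction t generalizing s with
  | zero => exact continuous_const
  | succ t ih =>
    simp only [stateLaw]
    fun_prop

theorem continuousOn_stateOccupancy (M : FiniteMDP S A) (s : S) :
    ContinuousOn (fun π : S → A → ℝ => M.stateOccupancy π s) (policies S A) :=
  continuousOn_tsum (fun t => (continuous_const.mul (M.continuous_stateLaw t s)).continuousOn)
    M.summable_discount fun t _ hπ => M.norm_discounted_stateLaw_le hπ t s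

theorem continuousOn_expect (M : FiniteMDP S A) {f : (S → A → ℝ) → S → A → ℝ}
    (hf : Continuous f) :
    ContinuousOn (fun π : S → A → ℝ => M.expect π (f π)) (policies S A) := by
  have h : ContinuousOn (fun π : S → A → ℝ =>
      ∑ s, ∑ a, M.stateOccupancy π s * π s a * f π s a) (policies S A) := by
    refine continuousOn_finsetSum _ fun s _ => continuousOn_finsetSum _ fun a _ => ?_
    refine ((M.continuousOn_stateOccupancy s).mul ?_).mul ?_
    · exact Continuous.continuousOn (by fun_prop)
    · exact Continuous.continuousOn (by fun_prop)
  exact h.congr fun π hπ => M.expect_eq hπ _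

theorem continuousOn_tsallisEntropy (M : FiniteMDP S A) :
    ContinuousOn M.tsallisEntropy (policies S A) :=
  continuousOn_const.mul (M.continuousOn_expect (by fun_prop))

end FiniteMDP

theorem isCompact_policies (S A : Type*) [Fintype A] : IsCompact (policies S A) := by
  have : policies S A = Set.univ.pi fun _ : S => stdSimplex ℝ A := by
    ext π
    simp [policies, stdSimplex, Set.mem_pi]
  rw [this]
  exact isCompact_univ_pi fun _ => isCompact_stdSimplex ℝ A

/-! ### A finite minimax theorem -/

/-- Fan's minimax argument for a finite family of functions satisfying a joint convexity
condition. -/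
theorem exists_forall_lt_of_convexLike {X ι : Type*} [Fintype ι] {P : Set X} (hP : P.Nonempty)
    {g : ι → X → ℝ}
    (hg : ∀ x ∈ P, ∀ y ∈ P, ∀ p q : ℝ, 0 ≤ p → 0 ≤ q → p + q = 1 →
      ∃ z ∈ P, ∀ i, g i z ≤ p * g i x + q * g i y) {c : ℝ}
    (h : ∀ w ∈ stdSimplex ℝ ι, ∃ x ∈ P, ∑ i, w i * g i x < c) :
    ∃ x ∈ P, ∀ i, g i x < c := by
  classical
  by_contra hcon
  -- If no `x` works, the constant vector `c` lies outside this open convex set; the coefficients of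
  -- a separating functional, once normalized, are weights contradicting `h`.
  set C : Set (ι → ℝ) := {z | ∃ x ∈ P, ∀ i, g i x < z i} with hC
  have hopen : IsOpen C := by
    have : C = ⋃ x ∈ P, Set.univ.pi fun i => Set.Ioi (g i x) := by
      ext z
      simp [hC, Set.mem_pi]
    rw [this]
    exact isOpen_biUnion fun x _ => isOpen_set_pi Set.finite_univ fun i _ => isOpen_Ioi
  have hconv : Convex ℝ C := by
    rintro z ⟨x, hx, hxz⟩ z' ⟨y, hy, hyz⟩ p q hp hq hpq
    obtain ⟨v, hv, hvg⟩ := hg x hx y hy p q hp hq hpq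
    refine ⟨v, hv, fun i => (hvg i).trans_lt ?_⟩
    simp only [Pi.add_apply, Pi.smul_apply, smul_eq_mul]
    rcases hp.eq_or_lt with rfl | hp'
    · rw [zero_add] at hpq
      subst hpq
      simpa using hyz i
    · exact add_lt_add_of_lt_of_le (mul_lt_mul_of_pos_left (hxz i) hp')
        (mul_le_mul_of_nonneg_left (hyz i).le hq)
  have hnot : (fun _ => c) ∉ C := hcon
  obtain ⟨f, hf⟩ := geometric_hahn_banach_point_open hconv hopen hnot
  set l : ι → ℝ := fun i => f (Pi.single i 1) with hl
  have hfl : ∀ z, f z = ∑ i, l i * z i := by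
    intro z
    conv_lhs => rw [← Finset.univ_sum_single z, map_sum]
    refine Finset.sum_congr rfl fun i _ => ?_
    have : (Pi.single i (z i) : ι → ℝ) = z i • Pi.single i 1 := by
      rw [← Pi.single_smul, smul_eq_mul, mul_one]
    rw [this, map_smul, smul_eq_mul, mul_comm]
  have hmem : ∀ x ∈ P, ∀ ε : ι → ℝ, (∀ i, 0 < ε i) → (fun i => g i x + ε i) ∈ C :=
    fun x hx ε hε => ⟨x, hx, fun i => lt_add_of_pos_right _ (hε i)⟩
  obtain ⟨x₀, hx₀⟩ := hP
  have hl0 : ∀ i, 0 ≤ l i := by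
    intro i
    by_contra hneg
    push Not at hneg
    -- `C` is upward closed, so coordinate `i` may be raised by `B / (-l i)`, which lowers `f` by
    -- exactly the gap `B` and destroys strict separation.
    set B := f (fun j => g j x₀ + 1) - f fun _ => c with hB
    have hBpos : 0 < B := sub_pos.2 (hf _ (hmem x₀ hx₀ (fun _ => 1) fun _ => one_pos))
    have key := hf _ (hmem x₀ hx₀ (fun j => 1 + Pi.single (M := fun _ => ℝ) i (B / (-l i)) j)
      fun j => add_pos_of_pos_of_nonneg one_pos
        ((Pi.single_nonneg.2 (div_nonneg hBpos.le (neg_pos.2 hneg).le) :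
          (0 : ι → ℝ) ≤ Pi.single i (B / (-l i))) j))
    have hsplit : (fun j => g j x₀ + (1 + Pi.single (M := fun _ => ℝ) i (B / (-l i)) j)) =
        (fun j => g j x₀ + 1) + (Pi.single i (B / (-l i)) : ι → ℝ) := by
      funext j
      simp [add_assoc]
    rw [hsplit, map_add, hfl (Pi.single i _)] at key
    simp only [Pi.single_apply, mul_ite, mul_zero, Finset.sum_ite_eq', Finset.mem_univ,
      if_true] at key
    have : l i * (B / (-l i)) = -B := by
      have := hneg.ne
      field_simp
    rw [this] at key
    linarith
  have hΛ : 0 < ∑ i, l i := by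
    refine (Finset.sum_nonneg fun i _ => hl0 i).lt_of_ne' fun h0 => ?_
    have hz := (Finset.sum_eq_zero_iff_of_nonneg fun i _ => hl0 i).1 h0
    have := hf _ (hmem x₀ hx₀ (fun _ => 1) fun _ => one_pos)
    rw [hfl, hfl, Finset.sum_eq_zero fun i hi => by rw [hz i hi, zero_mul],
      Finset.sum_eq_zero fun i hi => by rw [hz i hi, zero_mul]] at this
    exact lt_irrefl _ this
  obtain ⟨x, hx, hlt⟩ := h (fun i => l i / ∑ j, l j)
    ⟨fun i => div_nonneg (hl0 i) hΛ.le, by rw [← Finset.sum_div, div_self hΛ.ne']⟩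
  have hlt' : ∑ i, l i * g i x < c * ∑ j, l j := by
    simp_rw [div_mul_eq_mul_div, ← Finset.sum_div] at hlt
    exact (div_lt_iff₀ hΛ).1 hlt
  -- The weighted average slack: raising every `g i x` by `δ` stays in `C` but brings `f` to its
  -- value at the constant `c`.
  set δ := (c * ∑ j, l j - ∑ i, l i * g i x) / ∑ j, l j with hδ
  have := hf _ (hmem x hx (fun _ => δ) fun _ => div_pos (sub_pos.2 hlt') hΛ)
  rw [hfl, hfl] at this
  simp_rw [mul_add, Finset.sum_add_distrib, ← Finset.sum_mul] at this
  have h2 : (∑ i, l i) * δ = c * ∑ j, l j - ∑ i, l i * g i x := by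
    rw [hδ]
    field_simp
  linarith

/-! ### Extended-real convexity and minimizers -/

theorem EReal.iSup_sub_coe {ι : Sort*} (f : ι → EReal) (r : ℝ) :
    (⨆ i, f i) - (r : EReal) = ⨆ i, (f i - (r : EReal)) := by
  refine le_antisymm ?_ (iSup_le fun i => EReal.sub_le_sub (le_iSup f i) le_rfl)
  rw [EReal.sub_le_iff_le_add (.inl (EReal.coe_ne_bot r)) (.inl (EReal.coe_ne_top r))]
  refine iSup_le fun i => ?_
  rw [← EReal.sub_le_iff_le_add (.inl (EReal.coe_ne_bot r)) (.inl (EReal.coe_ne_top r))]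
  exact le_iSup (fun i => f i - (r : EReal)) i

/-- Jensen's inequality read off the epigraph; real bounds `r` avoid sums in `EReal`. -/
theorem ConvexEReal.le_sum {n : ℕ} {ψ : (Fin n → ℝ) → EReal} (hψ : ConvexEReal ψ)
    {ι : Type*} [Fintype ι] {w : ι → ℝ} (hw : w ∈ stdSimplex ℝ ι) (θ : ι → Fin n → ℝ)
    {r : ι → ℝ} (hr : ∀ i, ψ (θ i) ≤ (r i : EReal)) :
    ψ (∑ i, w i • θ i) ≤ ((∑ i, w i * r i : ℝ) : EReal) := by
  have h := hψ.sum_mem (t := Finset.univ) (w := w) (z := fun i => (θ i, r i))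
    (fun i _ => hw.1 i) hw.2 fun i _ => hr i
  simpa [Prod.fst_sum, Prod.snd_sum] using h

theorem convexConjugate_neg {n : ℕ} {ψ : (Fin n → ℝ) → EReal} (hψ : ∀ θ, ψ (-θ) = ψ θ)
    (x : Fin n → ℝ) : convexConjugate ψ (-x) = convexConjugate ψ x := by
  rw [convexConjugate, convexConjugate, ← (Equiv.neg (Fin n → ℝ)).iSup_comp]
  simp [hψ]

theorem minimizers_congr {X : Type*} {P : Set X} {F G : X → EReal} (h : ∀ x ∈ P, F x = G x) :
    minimizers P F = minimizers P G := by
  ext x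
  refine and_congr_right fun hx => ?_
  simp only [isMinOn_iff]
  refine forall₂_congr fun y hy => ?_
  rw [h x hx, h y hy]

theorem MaxMinEquivMin.congr {Θ X : Type*} {P : Set X} {L L' : Θ → X → EReal} {F : X → EReal}
    (h : MaxMinEquivMin P L F) (hL : ∀ θ, ∀ x ∈ P, L θ x = L' θ x) : MaxMinEquivMin P L' F := by
  have hinf : ∀ θ, ⨅ x ∈ P, L' θ x = ⨅ x ∈ P, L θ x :=
    fun θ => iInf_congr fun x => iInf_congr fun hx => (hL θ x hx).symm
  have hmin : ∀ θ, minimizers P (L' θ) = minimizers P (L θ) :=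
    fun θ => (minimizers_congr (hL θ)).symm
  refine ⟨fun θ => ?_, h.min_attained, ?_, fun θ => ?_⟩
  · rw [hmin]
    exact h.inner_min_attained θ
  · simp_rw [hinf]
    exact h.value_eq
  · simp_rw [hinf, hmin]
    exact h.solutions_eq θ

theorem iInf_eq_of_mem_minimizers {X : Type*} {P : Set X} {F : X → EReal} {x : X}
    (hx : x ∈ minimizers P F) : ⨅ y ∈ P, F y = F x :=
  le_antisymm (iInf₂_le x hx.1) (le_iInf₂ fun _ hy => hx.2 hy)

/-! ### The abstract equivalence -/

/-- A regularized max-min problem with bilinear coupling `θ ⬝ᵥ u x` is equivalent to the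
minimization of `ψ* (u x) - h x`, provided that `u` is affine and `h` strictly concave up to a
common reparametrization of the compact domain `P`. -/
theorem maxMinEquivMin_of_concaveLike {X : Type*} [TopologicalSpace X] {P : Set X}
    (hP : IsCompact P) (hne : P.Nonempty) {n : ℕ} {ψ : (Fin n → ℝ) → EReal}
    (hψ : ConvexEReal ψ) (hbot : ∀ θ, ψ θ ≠ ⊥) {u : X → Fin n → ℝ} {h : X → ℝ}
    (hu : ContinuousOn u P) (hh : ContinuousOn h P)
    (hmix : ∀ x ∈ P, ∀ y ∈ P, ∀ p q : ℝ, 0 ≤ p → 0 ≤ q → p + q = 1 →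
      ∃ z ∈ P, u z = p • u x + q • u y ∧ p * h x + q * h y ≤ h z ∧
        (0 < p → 0 < q → h z = p * h x + q * h y → u x = u y ∧ h x = h y)) :
    MaxMinEquivMin P (fun θ x => ((θ ⬝ᵥ u x : ℝ) : EReal) - ψ θ - (h x : EReal))
      (fun x => convexConjugate ψ (u x) - (h x : EReal)) := by
  classical
  set L : (Fin n → ℝ) → X → EReal := fun θ x => ((θ ⬝ᵥ u x : ℝ) : EReal) - ψ θ - (h x : EReal)
    with hL
  set F : X → EReal := fun x => convexConjugate ψ (u x) - (h x : EReal) with hF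
  have hFL : ∀ x, F x = ⨆ θ, L θ x := fun x => EReal.iSup_sub_coe _ _
  have hLtop : ∀ θ, ψ θ = ⊤ → ∀ x, L θ x = ⊥ := by
    intro θ hθ x
    simp only [hL, hθ]
    rw [EReal.sub_top, EReal.bot_sub]
  have hLreal : ∀ θ, ψ θ ≠ ⊤ → ∀ x,
      L θ x = ((θ ⬝ᵥ u x - (ψ θ).toReal - h x : ℝ) : EReal) := by
    intro θ hθ x
    rw [EReal.coe_sub, EReal.coe_sub, EReal.coe_toReal hθ (hbot θ)]
  have hcont : ∀ θ, ContinuousOn (L θ) P := by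
    intro θ
    by_cases hθ : ψ θ = ⊤
    · rw [funext (hLtop θ hθ)]
      exact continuousOn_const
    · rw [funext (hLreal θ hθ)]
      refine continuous_coe_real_ereal.comp_continuousOn
        ((ContinuousOn.sub ?_ continuousOn_const).sub hh)
      exact (continuous_const.dotProduct continuous_id).comp_continuousOn hu
  have hinner : ∀ θ, (minimizers P (L θ)).Nonempty := fun θ =>
    (hcont θ).lowerSemicontinuousOn.exists_isMinOn hne hP
  have hFmin : (minimizers P F).Nonempty := by
    have : LowerSemicontinuousOn F P := by
      rw [funext hFL]
      exact lowerSemicontinuousOn_iSup fun θ => (hcont θ).lowerSemicontinuousOn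
    exact this.exists_isMinOn hne hP
  have hvalue : (⨆ θ, ⨅ x ∈ P, L θ x) = ⨅ x ∈ P, F x := by
    refine le_antisymm (iSup_le fun θ => iInf₂_mono fun x _ => ?_) ?_
    · rw [hFL]
      exact le_iSup (fun θ => L θ x) θ
    refine EReal.le_of_forall_lt_iff_le.1 fun c hc => ?_
    have hfin : ∀ s : Finset {θ // ψ θ ≠ ⊤}, ∃ x ∈ P, ∀ θ ∈ s,
        L θ.1 x ≤ (c : EReal) := by
      intro s
      have := exists_forall_lt_of_convexLike (ι := s) hne
        (g := fun θ x => θ.1.1 ⬝ᵥ u x - (ψ θ.1.1).toReal - h x) ?_ (c := c) ?_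
      · obtain ⟨x, hx, hlt⟩ := this
        refine ⟨x, hx, fun θ hθ => ?_⟩
        rw [hLreal θ.1 θ.2, EReal.coe_le_coe_iff]
        exact (hlt ⟨θ, hθ⟩).le
      · intro x hx y hy p q hp hq hpq
        obtain ⟨z, hz, huz, hhz, -⟩ := hmix x hx y hy p q hp hq hpq
        refine ⟨z, hz, fun θ => ?_⟩
        rw [huz, dotProduct_add, dotProduct_smul, dotProduct_smul, smul_eq_mul, smul_eq_mul]
        have : (ψ θ.1.1).toReal = p * (ψ θ.1.1).toReal + q * (ψ θ.1.1).toReal := by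
          rw [← add_mul, hpq, one_mul]
        linarith
      · intro w hw
        -- By Jensen, the weighted sum of the functions `L (θ i)` is at most `L θ'`, whose minimum
        -- lies below `c`.
        set θ' := ∑ i : s, w i • i.1.1 with hθ'
        have hle := hψ.le_sum hw (fun i : s => i.1.1) (r := fun i => (ψ i.1.1).toReal)
          fun i => (EReal.coe_toReal i.1.2 (hbot _)).ge
        have hne_top : ψ θ' ≠ ⊤ := ne_top_of_le_ne_top (EReal.coe_ne_top _) hle
        obtain ⟨x, hx⟩ := hinner θ'
        have hxc : L θ' x < (c : EReal) := by
          rw [← iInf_eq_of_mem_minimizers hx]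
          exact (le_iSup (fun θ => ⨅ x ∈ P, L θ x) θ').trans_lt hc
        refine ⟨x, hx.1, ?_⟩
        rw [hLreal θ' hne_top, EReal.coe_lt_coe_iff] at hxc
        rw [← EReal.coe_toReal hne_top (hbot _), EReal.coe_le_coe_iff] at hle
        have hdot : θ' ⬝ᵥ u x = ∑ i : s, w i * (i.1.1 ⬝ᵥ u x) := by
          simp_rw [hθ', sum_dotProduct, smul_dotProduct, smul_eq_mul]
        simp_rw [mul_sub, Finset.sum_sub_distrib, ← Finset.sum_mul, hw.2, one_mul]
        rw [← hdot]
        linarith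
    -- Sublevel sets at `c` are relatively closed in the compact `P`, so finite intersections
    -- suffice.
    choose K hKc hK using fun θ : {θ // ψ θ ≠ ⊤} =>
      continuousOn_iff_isClosed.1 (hcont θ.1) (Set.Iic (c : EReal)) isClosed_Iic
    obtain ⟨x, hx, hxK⟩ := hP.inter_iInter_nonempty K hKc fun s => by
      obtain ⟨x, hx, hxs⟩ := hfin s
      refine ⟨x, hx, Set.mem_iInter₂.2 fun θ hθ => ?_⟩
      exact ((hK θ).subset ⟨hxs θ hθ, hx⟩).1
    refine (iInf₂_le x hx).trans ?_
    rw [hFL]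
    refine iSup_le fun θ => ?_
    by_cases hθ : ψ θ = ⊤
    · rw [hLtop θ hθ]
      exact bot_le
    · exact ((hK ⟨θ, hθ⟩).superset ⟨Set.mem_iInter.1 hxK ⟨θ, hθ⟩, hx⟩).1
  refine ⟨hinner, hFmin, hvalue, fun θ hθ => ?_⟩
  by_cases htop : ψ θ = ⊤
  -- An optimal `θ` with `ψ θ = ⊤` makes the optimal value `⊥`, so `L` and `F` are `⊥` throughout
  -- and every point is a minimizer.
  · have hLbot : ∀ θ' x, L θ' x = ⊥ := by
      intro θ' x
      by_contra hx
      have hθ' : ψ θ' ≠ ⊤ := fun h' => hx (hLtop θ' h' x)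
      obtain ⟨y, hy⟩ := hinner θ'
      obtain ⟨y₀, hy₀⟩ := hinner θ
      have := hθ θ'
      rw [iInf_eq_of_mem_minimizers hy, iInf_eq_of_mem_minimizers hy₀, hLtop θ htop,
        hLreal θ' hθ'] at this
      exact EReal.coe_ne_bot _ (le_bot_iff.1 this)
    refine minimizers_congr fun x _ => ?_
    rw [hFL]
    simp [hLbot]
  have hval : ⨅ x ∈ P, L θ x = ⨅ x ∈ P, F x := by
    rw [← hvalue]
    exact le_antisymm (le_iSup (fun θ => ⨅ x ∈ P, L θ x) θ) (iSup_le hθ)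
  have hsub : minimizers P F ⊆ minimizers P (L θ) := by
    intro x hx
    refine ⟨hx.1, fun y hy => ?_⟩
    calc L θ x ≤ F x := by
          rw [hFL]
          exact le_iSup (fun θ => L θ x) θ
      _ = ⨅ x ∈ P, L θ x := by rw [hval, iInf_eq_of_mem_minimizers hx]
      _ ≤ L θ y := iInf₂_le y hy
  refine Set.Subset.antisymm (fun x hx => ?_) hsub
  obtain ⟨y, hy⟩ := hFmin
  have hyL := hsub hy
  suffices hxy : u x = u y ∧ h x = h y by
    refine ⟨hx.1, fun z hz => ?_⟩
    have : F x = F y := by simp only [hF, hxy.1, hxy.2]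
    exact this.le.trans (hy.2 hz)
  -- `L θ` at the half-half mixture cannot fall below its minimum, so concavity of `h` is an
  -- equality there.
  obtain ⟨z, hz, huz, hhz, hstrict⟩ := hmix x hx.1 y hyL.1 (1 / 2) (1 / 2) (by norm_num)
    (by norm_num) (by norm_num)
  refine hstrict (by norm_num) (by norm_num) (le_antisymm ?_ hhz)
  have hxz := hx.2 hz
  have hyz := hyL.2 hz
  simp only [Set.mem_ofPred_eq, hLreal θ htop, EReal.coe_le_coe_iff] at hxz hyz
  rw [huz, dotProduct_add, dotProduct_smul, dotProduct_smul, smul_eq_mul, smul_eq_mul] at hxz hyz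
  linarith

/-! ### Application to the decision process -/

theorem FiniteMDP.expect_dotProduct {S A : Type*} [Fintype S] [Fintype A] (M : FiniteMDP S A)
    {n : ℕ} (φ : S → A → Fin n → ℝ) (θ : Fin n → ℝ) {π : S → A → ℝ} (hπ : π ∈ policies S A) :
    M.expect π (fun s a => θ ⬝ᵥ φ s a) = θ ⬝ᵥ M.featureExpect φ π := by
  have : M.featureExpect φ π = ∑ s, ∑ a, (M.stateOccupancy π s * π s a) • φ s a := by
    funext i
    simp only [featureExpect, M.expect_eq hπ, Finset.sum_apply, Pi.smul_apply, smul_eq_mul]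
  rw [this, M.expect_eq hπ]
  simp_rw [dotProduct_sum, dotProduct_smul, smul_eq_mul]

theorem theorem6 {S A : Type*} [Fintype S] [Fintype A] (M : FiniteMDP S A) {n : ℕ}
    (φ : S → A → Fin n → ℝ) (ψ : (Fin n → ℝ) → EReal) (hψ_convex : ConvexEReal ψ)
    (hψ_ne_bot : ∀ θ, ψ θ ≠ ⊥) (α : ℝ) (hα : 0 < α)
    (πE : S → A → ℝ) (hπE : πE ∈ policies S A) :
    MaxMinEquivMin (policies S A) (M.maxMinObjective φ ψ α πE)
      (fun π => convexConjugate ψ (M.featureExpect φ πE - M.featureExpect φ π)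
        - ((α * M.tsallisEntropy π : ℝ) : EReal)) ∧
    ((∀ θ, ψ (-θ) = ψ θ) →
      MaxMinEquivMin (policies S A) (M.maxMinObjective φ ψ α πE)
        (fun π => convexConjugate ψ (M.featureExpect φ π - M.featureExpect φ πE)
          - ((α * M.tsallisEntropy π : ℝ) : EReal))) := by
  have key : MaxMinEquivMin (policies S A) (M.maxMinObjective φ ψ α πE)
      (fun π => convexConjugate ψ (M.featureExpect φ πE - M.featureExpect φ π)
        - ((α * M.tsallisEntropy π : ℝ) : EReal)) := by
    refine (maxMinEquivMin_of_concaveLike (isCompact_policies S A) ⟨πE, hπE⟩ hψ_convex hψ_ne_bot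
      (u := fun π => M.featureExpect φ πE - M.featureExpect φ π)
      (h := fun π => α * M.tsallisEntropy π) ?_ ?_ ?_).congr ?_
    · exact continuousOn_const.sub
        (continuousOn_pi.2 fun i => M.continuousOn_expect continuous_const)
    · exact continuousOn_const.mul M.continuousOn_tsallisEntropy
    · intro π₁ h₁ π₂ h₂ p q hp hq hpq
      obtain ⟨π, hπ, hE, hW, hstrict⟩ := M.exists_combination h₁ h₂ hp hq hpq
      refine ⟨π, hπ, ?_, ?_, fun hp' hq' heq => ?_⟩
      · funext i
        simp only [FiniteMDP.featureExpect, Pi.sub_apply, Pi.add_apply, Pi.smul_apply, smul_eq_mul,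
          hE]
        linear_combination (-M.expect πE fun s a => φ s a i) * hpq
      · nlinarith
      · have hocc := hstrict hp' hq' (mul_left_cancel₀ hα.ne' (by linarith))
        refine ⟨?_, congrArg (α * ·) (M.tsallisEntropy_congr_occupancy h₁ h₂ hocc)⟩
        funext i
        exact congrArg (M.featureExpect φ πE i - ·) (M.expect_congr_occupancy h₁ h₂ hocc _)
    · intro θ π hπ
      have hreal : -α * M.tsallisEntropy π - M.expect π (fun s a => θ ⬝ᵥ φ s a)
          + M.expect πE (fun s a => θ ⬝ᵥ φ s a) =
          θ ⬝ᵥ (M.featureExpect φ πE - M.featureExpect φ π) - α * M.tsallisEntropy π := by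
        rw [M.expect_dotProduct φ θ hπ, M.expect_dotProduct φ θ hπE, dotProduct_sub]
        ring
      rw [FiniteMDP.maxMinObjective, hreal, EReal.coe_sub]
      simp only [sub_eq_add_neg (G := EReal), add_right_comm]
  refine ⟨key, fun hsymm => ?_⟩
  simp_rw [fun π => (neg_sub (M.featureExpect φ πE) (M.featureExpect φ π)).symm,
    convexConjugate_neg hsymm]
  exact key

end
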